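/- Let $n\ge 1$, let $A$ be a ring with identity, let $A_2,\dots,A_n$ be subrings of $A$ with the same identity as $A$, and let $I_i$ ($2\le i\le n$) and $I_{ij}$ ($2\le j<i\le n$) be two-sided ideals of $A$ such that $I_n\subseteq I_{n-1}\subseteq\cdots\subseteq I_2$, $I_i\subseteq A_i$ for $2\le i\le n$, and $I_j\subseteq I_{ij}$ and $\sum_{l=j+1}^{i-1} I_{il}I_{lj}\subseteq I_{ij}$ for $2\le j<i\le n$. Let $\Lambda$ be the subring of the full matrix ring $M_n(A)$ consisting of all matrices $(a_{ij})$ such that, for all $1\le i\le n$ and $2\le j\le n$, $a_{ij}\in I_j$ if $i<j$, $a_{jj}\in A_j$, and $a_{ij}\in I_{ij}$ if $i>j$ (the entries $a_{i1}\in A$ of the first column are arbitrary); that is, $$\Lambda=\begin{pmatrix} A & I_2 & I_3 & \cdots & I_{n-1} & I_n\\ A & A_2 & I_3 & \cdots & I_{n-1} & I_n\\ A & I_{32} & A_3 & \cdots & I_{n-1} & I_n\\ A & I_{42} & I_{43} & \ddots & & \vdots\\ \vdots & \vdots & \vdots & & \ddots & I_n\\ A & I_{n2} & I_{n3} & \cdots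 & I_{n,n-1} & A_n \end{pmatrix}.$$ For a ring $R$ let $\mathrm{l.gl.dim}(R)\in\{0,1,2,\dots\}\cup\{\infty\}$ be the supremum of the projective dimensions of all left $R$-modules, the zero module being given projective dimension $0$ (so that the zero ring has left global dimension $0$). Then $$\max\{\mathrm{l.gl.dim}(A),\ \mathrm{l.gl.dim}(A_i/I_i)\ (2\le i\le n)\}-1\ \le\ \mathrm{l.gl.dim}(\Lambda)\ \le\ \sum_{i=2}^n \mathrm{l.gl.dim}(A_i/I_i)+\mathrm{l.gl.dim}(A)+n .$$ -/

import Mathlib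

universe u

/-- The left global dimension of a ring `R`: the supremum of the projective dimensions of all
left `R`-modules, as an element of `ℕ∞`. Mathlib's `projectiveDimension` gives the zero module the
value `⊥`; here the zero module counts as having projective dimension `0`, which only matters for
the zero ring (whose left global dimension is therefore `0`). -/
noncomputable def leftGlobalDimension (R : Type u) [Ring R] : ℕ∞ :=
  ⨆ M : ModuleCat.{u} R, (CategoryTheory.projectiveDimension M).unbotD 0

/-- The data from which the matrix ring is built, for matrices of size `n = m + 1`. The index set
`{2, …, n}` is represented by `Fin m`, the element `i : Fin m` standing for the index `i + 2`.
All ideals are two-sided. The ideals `K i j` are meaningful only for `j < i`, and nothing is required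
of them (or used) for other pairs. -/
structure MatrixSubringData (A : Type u) [Ring A] (m : ℕ) where
  /-- the subrings `A_i` (with the same identity as `A`) -/
  B : Fin m → Subring A
  /-- the ideals `I_i` -/
  I : Fin m → Ideal A
  /-- the ideals `I_{ij}`, `j < i` -/
  K : Fin m → Fin m → Ideal A
  I_twoSided : ∀ i, (I i).IsTwoSided
  K_twoSided : ∀ i j, j < i → (K i j).IsTwoSided
  I_anti : ∀ i j, i ≤ j → I j ≤ I i
  I_le_B : ∀ i, (I i : Set A) ⊆ B i
  I_le_K : ∀ i j, j < i → I j ≤ K i j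
  K_mul_le : ∀ i j, j < i → ∑ l ∈ Finset.Ioo j i, K i l * K l j ≤ K i j

namespace MatrixSubringData

variable {A : Type u} [Ring A] {m : ℕ} (D : MatrixSubringData A m)

instance instIsTwoSidedI (i : Fin m) : (D.I i).IsTwoSided := D.I_twoSided i

/-- The entry set in row `i` and column `j`: column `0` is filled with `A`; in column `j + 1` the
entry set is `I_j` strictly above the diagonal, `A_j` on it, and `I_{ij}` strictly below it. -/
def entry (i j : Fin (m + 1)) : AddSubgroup A :=
  Fin.cases ⊤
    (fun j' => Fin.cases (D.I j').toAddSubgroup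
      (fun i' => if i' < j' then (D.I j').toAddSubgroup
        else if i' = j' then (D.B j').toAddSubgroup
        else (D.K i' j').toAddSubgroup) i) j

theorem mem_entry_zero (i : Fin (m + 1)) (a : A) : a ∈ D.entry i 0 := by
  simp [entry]

theorem mem_entry_zero_succ (j : Fin m) (a : A) : a ∈ D.entry 0 j.succ ↔ a ∈ D.I j := by
  simp [entry]

theorem mem_entry_of_lt {i j : Fin m} (h : i < j) (a : A) :
    a ∈ D.entry i.succ j.succ ↔ a ∈ D.I j := by
  simp [entry, h]

theorem mem_entry_diag (i : Fin m) (a : A) : a ∈ D.entry i.succ i.succ ↔ a ∈ D.B i := by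
  simp [entry]

theorem mem_entry_of_gt {i j : Fin m} (h : j < i) (a : A) :
    a ∈ D.entry i.succ j.succ ↔ a ∈ D.K i j := by
  simp [entry, h.not_gt, h.ne']

theorem I_le_entry (i : Fin (m + 1)) (j : Fin m) {a : A} (ha : a ∈ D.I j) :
    a ∈ D.entry i j.succ := by
  induction i using Fin.cases with
  | zero => exact (D.mem_entry_zero_succ j a).2 ha
  | succ i =>
    rcases lt_trichotomy i j with h | h | h
    · exact (D.mem_entry_of_lt h a).2 ha
    · subst h
      exact (D.mem_entry_diag i a).2 (D.I_le_B i ha)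
    · exact (D.mem_entry_of_gt h a).2 (D.I_le_K i j h ha)

theorem one_mem_entry (i : Fin (m + 1)) : (1 : A) ∈ D.entry i i := by
  induction i using Fin.cases with
  | zero => exact D.mem_entry_zero _ _
  | succ i => exact (D.mem_entry_diag i 1).2 (D.B i).one_mem

theorem mul_mem_entry {i l j : Fin (m + 1)} {a b : A} (ha : a ∈ D.entry i l)
    (hb : b ∈ D.entry l j) : a * b ∈ D.entry i j := by
  induction j using Fin.cases with
  | zero => exact D.mem_entry_zero _ _
  | succ j =>
    induction l using Fin.cases with
    | zero =>
      exact D.I_le_entry i j ((D.I j).mul_mem_left a ((D.mem_entry_zero_succ j b).1 hb))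
    | succ l =>
      rcases lt_trichotomy l j with h | h | h
      · exact D.I_le_entry i j ((D.I j).mul_mem_left a ((D.mem_entry_of_lt h b).1 hb))
      · subst h
        induction i using Fin.cases with
        | zero =>
          exact D.I_le_entry 0 l ((D.I l).mul_mem_right b ((D.mem_entry_zero_succ l a).1 ha))
        | succ i =>
          rcases lt_trichotomy i l with h' | h' | h'
          · exact D.I_le_entry _ l ((D.I l).mul_mem_right b ((D.mem_entry_of_lt h' a).1 ha))
          · subst h'
            exact (D.mem_entry_diag i _).2
              ((D.B i).mul_mem ((D.mem_entry_diag i a).1 ha) ((D.mem_entry_diag i b).1 hb))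
          · have := D.K_twoSided i l h'
            exact (D.mem_entry_of_gt h' _).2
              ((D.K i l).mul_mem_right b ((D.mem_entry_of_gt h' a).1 ha))
      · induction i using Fin.cases with
        | zero =>
          exact D.I_le_entry 0 j (D.I_anti j l h.le
            ((D.I l).mul_mem_right b ((D.mem_entry_zero_succ l a).1 ha)))
        | succ i =>
          rcases lt_trichotomy i l with h' | h' | h'
          · exact D.I_le_entry _ j (D.I_anti j l h.le
              ((D.I l).mul_mem_right b ((D.mem_entry_of_lt h' a).1 ha)))
          · subst h'
            exact (D.mem_entry_of_gt h _).2
              ((D.K i j).mul_mem_left a ((D.mem_entry_of_gt h b).1 hb))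
          · have hij := h.trans h'
            refine (D.mem_entry_of_gt hij _).2 (D.K_mul_le i j hij ?_)
            have hle : D.K i l * D.K l j ≤ ∑ l ∈ Finset.Ioo j i, D.K i l * D.K l j :=
              Finset.single_le_sum (f := fun l => D.K i l * D.K l j) (fun _ _ => bot_le)
                (Finset.mem_Ioo.2 ⟨h, h'⟩)
            exact hle (Ideal.mul_mem_mul ((D.mem_entry_of_gt h' a).1 ha)
              ((D.mem_entry_of_gt h b).1 hb))

/-- The ring `Λ`: all `n × n` matrices over `A` (`n = m + 1`) whose `(i, j)` entry lies in the
prescribed entry set, as a subring of the full matrix ring. -/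
def Lambda : Subring (Matrix (Fin (m + 1)) (Fin (m + 1)) A) where
  carrier := {M | ∀ i j, M i j ∈ D.entry i j}
  zero_mem' i j := (D.entry i j).zero_mem
  add_mem' hM hN i j := (D.entry i j).add_mem (hM i j) (hN i j)
  neg_mem' hM i j := (D.entry i j).neg_mem (hM i j)
  one_mem' i j := by
    rw [Matrix.one_apply]
    split_ifs with h
    · subst h
      exact D.one_mem_entry i
    · exact (D.entry i j).zero_mem
  mul_mem' hM hN i j := by
    rw [Matrix.mul_apply]
    exact (D.entry i j).sum_mem fun l _ => D.mul_mem_entry (hM i l) (hN l j)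

/-- The quotient ring `A_i / I_i`, where `I_i ⊆ A_i` is regarded as an ideal of `A_i`. -/
abbrev DiagQuotient (i : Fin m) : Type u :=
  D.B i ⧸ (D.I i).comap (D.B i).subtype

end MatrixSubringData

/-! Number rows and columns from 0 and write e_ij for matrix units, so that `col i` is e_i0 and
`idem i` is e_ii; Λ contains all of these. Sending an A-module N to the columns with entries in N is
the functor Λe_00 ⊗_A N. It is exact and it preserves and reflects projectives, hence projective
dimension. On the other side, the diagonal entry modulo I_k is a ring homomorphism Λ → A_k/I_k
(`diag`), along which modules can be inflated.

A module M is admissible of level n if every e_i0 : e_00 M → e_ii M is injective, and also onto for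
i < n. It then contains the columns over its corner, and the quotient lives in positions ≥ n. At
level k + 1 the first uncontrolled position is `k.succ`; there the cokernel of e_00 M → e_ii M is an
A_k/I_k-module, the top of M. Taking tops is left adjoint to inflation, so it preserves projectives,
and injectivity of the e_i0 makes it exact on admissible sequences.

Lower bound: tops do not raise projective dimension (`IsTop.hasProjDimLE`), and X is the top of its
own inflation; columns give the bound for A. The resulting bound holds even without the -1.

Upper bound: a module supported in positions ≥ k + 1 is an extension of an inflated top by a module
supported in positions ≥ k + 2. Descending induction bounds it by a + Σ (d_k + 1), with a and d_k
bounding the global dimensions of A and A_k/I_k (`hasProjDimLE_of_isBelow`). One more unit comes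
from replacing an arbitrary module by the kernel of a free cover, which is admissible of level 1. -/

open CategoryTheory

/-! ### Projective dimension and short exact sequences -/

/-- The `R`-module `M` has projective dimension at most `n`. -/
def HasProjDimLE (R M : Type u) [Ring R] [AddCommGroup M] [Module R M] (n : ℕ) : Prop :=
  HasProjectiveDimensionLE (ModuleCat.of R M) n

section HasProjDimLE

variable {R : Type u} [Ring R] {M M' M'' : Type u} [AddCommGroup M] [Module R M]
  [AddCommGroup M'] [Module R M'] [AddCommGroup M''] [Module R M'']

theorem hasProjDimLE_zero_iff : HasProjDimLE R M 0 ↔ Module.Projective R M :=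
  (projective_iff_hasProjectiveDimensionLE_zero _).symm.trans
    (IsProjective.iff_projective (R := R) M).symm

theorem HasProjDimLE.mono {n k : ℕ} (h : HasProjDimLE R M n) (hnk : n ≤ k) :
    HasProjDimLE R M k := by
  unfold HasProjDimLE at *
  exact hasProjectiveDimensionLT_of_ge _ (n + 1) (k + 1) (by omega)

theorem Module.Projective.hasProjDimLE [h : Module.Projective R M] (n : ℕ) :
    HasProjDimLE R M n :=
  (hasProjDimLE_zero_iff.2 h).mono n.zero_le

theorem HasProjDimLE.of_retract {n : ℕ} (h : HasProjDimLE R M n) (i : M' →ₗ[R] M)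
    (p : M →ₗ[R] M') (hpi : p ∘ₗ i = LinearMap.id) : HasProjDimLE R M' n := by
  unfold HasProjDimLE at *
  let r : Retract (ModuleCat.of R M') (ModuleCat.of R M) :=
    { i := ModuleCat.ofHom i, r := ModuleCat.ofHom p
      retract := by rw [← ModuleCat.ofHom_comp, hpi]; rfl }
  exact r.hasProjectiveDimensionLT _

theorem hasProjDimLE_of_subsingleton [Subsingleton M] (n : ℕ) : HasProjDimLE R M n :=
  Module.Projective.hasProjDimLE n

variable {f : M' →ₗ[R] M} {g : M →ₗ[R] M''}

theorem shortExact_of_linearMap (hf : Function.Injective f) (hfg : Function.Exact f g)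
    (hg : Function.Surjective g) :
    (ShortComplex.mk (ModuleCat.ofHom f) (ModuleCat.ofHom g) (by
      rw [← ModuleCat.ofHom_comp, hfg.linearMap_comp_eq_zero]; rfl)).ShortExact :=
  ModuleCat.shortComplex_shortExact _ hfg hf hg

theorem HasProjDimLE.middle {n : ℕ} (h' : HasProjDimLE R M' n) (h'' : HasProjDimLE R M'' n)
    (hf : Function.Injective f) (hfg : Function.Exact f g) (hg : Function.Surjective g) :
    HasProjDimLE R M n :=
  (shortExact_of_linearMap hf hfg hg).hasProjectiveDimensionLT_X₂ _ h' h''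

theorem HasProjDimLE.right {n : ℕ} (h' : HasProjDimLE R M' n) (h : HasProjDimLE R M (n + 1))
    (hf : Function.Injective f) (hfg : Function.Exact f g) (hg : Function.Surjective g) :
    HasProjDimLE R M'' (n + 1) :=
  (shortExact_of_linearMap hf hfg hg).hasProjectiveDimensionLT_X₃ _ h' h

theorem HasProjDimLE.left {n : ℕ} (h : HasProjDimLE R M n) (h'' : HasProjDimLE R M'' (n + 1))
    (hf : Function.Injective f) (hfg : Function.Exact f g) (hg : Function.Surjective g) :
    HasProjDimLE R M' n :=
  (shortExact_of_linearMap hf hfg hg).hasProjectiveDimensionLT_X₁ _ h h''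

theorem HasProjDimLE.of_ker {n : ℕ} (hg : Function.Surjective g)
    (h' : HasProjDimLE R (LinearMap.ker g) n) (h : HasProjDimLE R M (n + 1)) :
    HasProjDimLE R M'' (n + 1) :=
  h'.right h (LinearMap.ker g).injective_subtype (LinearMap.exact_subtype_ker_map g) hg

theorem HasProjDimLE.ker {n : ℕ} [Module.Projective R M] (h'' : HasProjDimLE R M'' (n + 1))
    (hg : Function.Surjective g) : HasProjDimLE R (LinearMap.ker g) n :=
  (Module.Projective.hasProjDimLE n).left h'' (LinearMap.ker g).injective_subtype
    (LinearMap.exact_subtype_ker_map g) hg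

variable (R M) in
theorem exists_projective_surjective :
    ∃ (P : Type u) (_ : AddCommGroup P) (_ : Module R P) (g : P →ₗ[R] M),
      Module.Projective R P ∧ Function.Surjective g :=
  ⟨M →₀ R, inferInstance, inferInstance, Finsupp.linearCombination R id, inferInstance,
    Finsupp.linearCombination_id_surjective R M⟩

variable (R) in
theorem leftGlobalDimension_le_iff {n : ℕ} :
    leftGlobalDimension R ≤ n ↔
      ∀ (M : Type u) [AddCommGroup M] [Module R M], HasProjDimLE R M n := by
  unfold leftGlobalDimension
  rw [iSup_le_iff]
  -- Replacing `⊥` by 0 is harmless, since the bound is a natural number.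
  have key (M : ModuleCat.{u} R) : (projectiveDimension M).unbotD 0 ≤ (n : ℕ∞) ↔
      HasProjectiveDimensionLE M n := by
    rw [← projectiveDimension_le_iff, WithBot.unbotD_le_iff (by simp)]
    rfl
  simp only [key]
  exact ⟨fun h M _ _ => h (ModuleCat.of R M), fun h M => h M⟩

end HasProjDimLE

/-! ### Descent of modules along a surjective ring homomorphism -/

section Descent

variable {R S : Type u} [Ring R] [Ring S] (π : R →+* S)

/-- A module over `R` annihilated by the kernel of a surjective ring homomorphism `R → S` is a
module over `S`. -/
noncomputable abbrev moduleOfSurjective (hπ : Function.Surjective π) (Y : Type u) [AddCommGroup Y]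
    [Module R Y] (h : ∀ r, π r = 0 → ∀ y : Y, r • y = 0) : Module S Y :=
  have key (r r' : R) (e : π r = π r') (y : Y) : r • y = r' • y := by
    rw [← sub_eq_zero, ← sub_smul]
    exact h _ (by rw [map_sub, e, sub_self]) y
  have hs := Function.surjInv_eq hπ
  { smul s y := Function.surjInv hπ s • y
    one_smul y := (key _ 1 (by rw [hs, map_one]) y).trans (one_smul R y)
    mul_smul s t y := (key _ (Function.surjInv hπ s * Function.surjInv hπ t)
      (by rw [hs, map_mul, hs, hs]) y).trans (mul_smul _ _ y)
    smul_zero s := smul_zero (Function.surjInv hπ s)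
    smul_add s x y := smul_add (Function.surjInv hπ s) x y
    add_smul s t y := (key _ (Function.surjInv hπ s + Function.surjInv hπ t)
      (by rw [hs, map_add, hs, hs]) y).trans (add_smul _ _ y)
    zero_smul y := (key _ 0 (by rw [hs, map_zero]) y).trans (zero_smul R y) }

theorem smul_eq_moduleOfSurjective_smul (hπ : Function.Surjective π) (Y : Type u)
    [AddCommGroup Y] [Module R Y] (h : ∀ r, π r = 0 → ∀ y : Y, r • y = 0) (r : R) (y : Y) :
    letI := moduleOfSurjective π hπ Y h
    r • y = π r • y := by
  change r • y = Function.surjInv hπ (π r) • y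
  rw [← sub_eq_zero, ← sub_smul]
  exact h _ (by rw [map_sub, Function.surjInv_eq hπ, sub_self]) y

end Descent

/-! ### Matrix units of Λ -/

namespace MatrixSubringData

variable {A : Type u} [Ring A] {m : ℕ} (D : MatrixSubringData A m)

/-- The element of `Λ` with the single nonzero entry `a` in position `(i, j)`. -/
def single (i j : Fin (m + 1)) (a : A) (h : a ∈ D.entry i j) : D.Lambda :=
  ⟨Matrix.single i j a, fun i' j' => by
    rw [Matrix.single_apply]
    split_ifs with e
    · obtain ⟨rfl, rfl⟩ := e
      exact h
    · exact zero_mem _⟩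

/-- The matrix unit in position `(i, 0)`. -/
def col (i : Fin (m + 1)) : D.Lambda := D.single i 0 1 (D.mem_entry_zero _ _)

/-- The matrix unit in position `(i, i)`. -/
def idem (i : Fin (m + 1)) : D.Lambda := D.single i i 1 (D.one_mem_entry _)

/-- The inclusion of `A` as the upper left corner of `Λ`. -/
def corner (a : A) : D.Lambda := D.single 0 0 a (D.mem_entry_zero _ _)

theorem single_mul_single {i j l : Fin (m + 1)} {a b : A} (ha : a ∈ D.entry i j)
    (hb : b ∈ D.entry j l) :
    D.single i j a ha * D.single j l b hb = D.single i l (a * b) (D.mul_mem_entry ha hb) :=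
  Subtype.ext (by simp [single])

theorem single_mul_single_of_ne {i j j' l : Fin (m + 1)} {a b : A} (ha : a ∈ D.entry i j)
    (hb : b ∈ D.entry j' l) (hj : j ≠ j') : D.single i j a ha * D.single j' l b hb = 0 :=
  Subtype.ext (by simp [single, hj])

@[simp] theorem col_mul_col_zero (i : Fin (m + 1)) : D.col i * D.col 0 = D.col i := by
  simp [col, single_mul_single]

theorem idem_zero : D.idem 0 = D.col 0 := rfl

theorem corner_one : D.corner 1 = D.col 0 := rfl

@[simp] theorem idem_mul_col (i : Fin (m + 1)) : D.idem i * D.col i = D.col i := by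
  simp [col, idem, single_mul_single]

theorem idem_mul_col_of_ne {i j : Fin (m + 1)} (h : i ≠ j) : D.idem i * D.col j = 0 :=
  D.single_mul_single_of_ne _ _ h

theorem single_mul_idem {i j : Fin (m + 1)} {a : A} (ha : a ∈ D.entry i j) :
    D.single i j a ha * D.idem j = D.single i j a ha := by
  simp [idem, single_mul_single]

theorem single_mul_col {i j : Fin (m + 1)} {a : A} (ha : a ∈ D.entry i j) :
    D.single i j a ha * D.col j = D.col i * D.corner a := by
  simp [col, corner, single_mul_single]

theorem col_mul_single {i j : Fin (m + 1)} {a : A} (ha : a ∈ D.entry 0 j)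
    (ha' : a ∈ D.entry i j) : D.col i * D.single 0 j a ha = D.single i j a ha' := by
  simp [col, single_mul_single]

theorem corner_mul (a b : A) : D.corner (a * b) = D.corner a * D.corner b := by
  simp [corner, single_mul_single]

theorem corner_add (a b : A) : D.corner (a + b) = D.corner a + D.corner b :=
  Subtype.ext (by simp [corner, single, Matrix.single_add])

theorem corner_zero : D.corner 0 = 0 :=
  Subtype.ext (by simp [corner, single])

theorem col_zero_mul_corner (a : A) : D.col 0 * D.corner a = D.corner a := by
  rw [← corner_one, ← corner_mul, one_mul]

theorem sum_idem : ∑ i, D.idem i = 1 := by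
  refine Subtype.ext ?_
  ext i j
  simp [idem, single, Matrix.sum_apply, Matrix.single_apply, Matrix.one_apply, ite_and]

theorem idem_mul (k : Fin (m + 1)) (r : D.Lambda) :
    D.idem k * r = ∑ j, D.single k j (r.1 k j) (r.2 k j) := by
  refine Subtype.ext ?_
  ext i j
  by_cases h : k = i
  · subst h
    simp [idem, single, Matrix.sum_apply, Matrix.single_apply]
  · rw [Subring.coe_mul]
    simp [idem, single, Matrix.sum_apply, h, Matrix.single_mul_apply_of_ne _ _ _ _ _ (Ne.symm h)]

theorem mul_col (r : D.Lambda) (j : Fin (m + 1)) :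
    r * D.col j = ∑ i, D.col i * D.corner (r.1 i j) := by
  refine Subtype.ext ?_
  ext i l
  by_cases h : l = 0
  · subst h
    simp [col, corner, single, Matrix.sum_apply, Matrix.single_apply]
  · simp [col, corner, single, Matrix.sum_apply, Ne.symm h, h]

section Modules

variable {M : Type u} [AddCommGroup M] [Module D.Lambda M]

theorem sum_idem_smul (x : M) : ∑ i, D.idem i • x = x := by
  rw [← Finset.sum_smul, sum_idem, one_smul]

theorem eq_zero_of_idem_smul {x : M} (h : ∀ i, D.idem i • x = 0) : x = 0 := by
  rw [← D.sum_idem_smul x]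
  exact Finset.sum_eq_zero fun i _ => h i

theorem idem_smul_smul (k : Fin (m + 1)) (r : D.Lambda) (x : M) :
    D.idem k • r • x = ∑ j, D.single k j (r.1 k j) (r.2 k j) • x := by
  rw [smul_smul, idem_mul, Finset.sum_smul]

end Modules

/-! ### Column modules and the corner at position 0 -/

/-- For an `A`-module `N`, the `Λ`-module of columns with entries in `N`. -/
def Col (_ : MatrixSubringData A m) (N : Type u) : Type u := Fin (m + 1) → N

namespace Col

variable {N N' N'' : Type u} [AddCommGroup N] [Module A N] [AddCommGroup N'] [Module A N']
  [AddCommGroup N''] [Module A N'']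

instance : AddCommGroup (D.Col N) := inferInstanceAs (AddCommGroup (Fin (m + 1) → N))

instance : Module D.Lambda (D.Col N) where
  smul r v := fun i => ∑ j, r.1 i j • v j
  one_smul v := funext fun i => by
    change ∑ j, (1 : Matrix (Fin (m + 1)) (Fin (m + 1)) A) i j • v j = v i
    rw [Finset.sum_eq_single i (fun j _ hj => by rw [Matrix.one_apply_ne hj.symm, zero_smul])
      (by simp), Matrix.one_apply_eq, one_smul]
  mul_smul r s v := funext fun i => by
    change ∑ j, (r.1 * s.1) i j • v j = ∑ l, r.1 i l • ∑ j, s.1 l j • v j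
    simp only [Matrix.mul_apply, Finset.sum_smul, Finset.smul_sum, mul_smul]
    exact Finset.sum_comm
  smul_zero r := funext fun i => Finset.sum_eq_zero fun j _ => smul_zero (r.1 i j)
  smul_add r v w := funext fun i => by
    change ∑ j, r.1 i j • (v j + w j) = ∑ j, r.1 i j • v j + ∑ j, r.1 i j • w j
    simp only [smul_add, Finset.sum_add_distrib]
  add_smul r s v := funext fun i => by
    change ∑ j, (r.1 i j + s.1 i j) • v j = ∑ j, r.1 i j • v j + ∑ j, s.1 i j • v j
    simp only [add_smul, Finset.sum_add_distrib]
  zero_smul v := funext fun i => Finset.sum_eq_zero fun j _ => zero_smul A (v j)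

variable {D}

theorem smul_apply (r : D.Lambda) (v : D.Col N) (i : Fin (m + 1)) :
    (r • v) i = ∑ j, r.1 i j • v j := rfl

omit [Module A N] in
theorem add_apply (v w : D.Col N) (i : Fin (m + 1)) : (v + w) i = v i + w i := rfl

omit [Module A N] in
theorem sum_apply {ι : Type*} (s : Finset ι) (v : ι → D.Col N) (i : Fin (m + 1)) :
    (∑ k ∈ s, v k) i = ∑ k ∈ s, v k i :=
  Finset.sum_apply i s v

theorem single_smul_apply {i j : Fin (m + 1)} {a : A} (ha : a ∈ D.entry i j) (v : D.Col N)
    (l : Fin (m + 1)) : (D.single i j a ha • v) l = if i = l then a • v j else 0 := by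
  rw [smul_apply]
  by_cases h : i = l
  · simp [single, Matrix.single_apply, h]
  · simp [single, h]

/-- The linear map of columns induced by a linear map of the entries. -/
def map (f : N →ₗ[A] N') : D.Col N →ₗ[D.Lambda] D.Col N' where
  toFun v := fun i => f (v i)
  map_add' v w := funext fun i => f.map_add (v i) (w i)
  map_smul' r v := funext fun i => by
    simp only [smul_apply, map_sum, map_smul]
    rfl

theorem map_injective {f : N →ₗ[A] N'} (hf : Function.Injective f) :
    Function.Injective (map (D := D) f) :=
  fun _ _ h => funext fun i => hf (congrFun h i)

theorem map_surjective {f : N →ₗ[A] N'} (hf : Function.Surjective f) :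
    Function.Surjective (map (D := D) f) := fun v => by
  choose w hw using fun i => hf (v i)
  exact ⟨w, funext hw⟩

theorem map_exact {f : N →ₗ[A] N'} {g : N' →ₗ[A] N''} (h : Function.Exact f g) :
    Function.Exact (map (D := D) f) (map g) := fun v => by
  constructor
  · intro hv
    choose w hw using fun i => (h (v i)).1 (congrFun hv i)
    exact ⟨w, funext hw⟩
  · rintro ⟨w, rfl⟩
    exact funext fun i => (h _).2 ⟨w i, rfl⟩

end Col

/-- The corner of a `Λ`-module, an `A`-module. -/
def Corner (M : Type u) [AddCommGroup M] [Module D.Lambda M] : AddSubgroup M where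
  carrier := {x | D.col 0 • x = x}
  zero_mem' := smul_zero _
  add_mem' hx hy := (smul_add _ _ _).trans (congrArg₂ _ hx hy)
  neg_mem' hx := (smul_neg _ _).trans (congrArg _ hx)

section Corner

variable {D} {M : Type u} [AddCommGroup M] [Module D.Lambda M]

theorem col_zero_smul_mem_corner (x : M) : D.col 0 • x ∈ D.Corner M := by
  change D.col 0 • D.col 0 • x = D.col 0 • x
  rw [smul_smul, col_mul_col_zero]

instance : Module A (D.Corner M) where
  smul a x := ⟨D.corner a • (x : M), by
    change D.col 0 • D.corner a • (x : M) = D.corner a • (x : M)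
    rw [smul_smul, col_zero_mul_corner]⟩
  one_smul x := Subtype.ext x.2
  mul_smul a b x := Subtype.ext (by
    change D.corner (a * b) • (x : M) = D.corner a • D.corner b • (x : M)
    rw [smul_smul, corner_mul])
  smul_zero a := Subtype.ext (smul_zero _)
  smul_add a x y := Subtype.ext (smul_add _ _ _)
  add_smul a b x := Subtype.ext (by
    change D.corner (a + b) • (x : M) = D.corner a • (x : M) + D.corner b • (x : M)
    rw [corner_add, add_smul])
  zero_smul x := Subtype.ext (by
    change D.corner 0 • (x : M) = 0
    rw [corner_zero, zero_smul])

theorem coe_corner_smul (a : A) (x : D.Corner M) : ((a • x : D.Corner M) : M) = D.corner a • x :=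
  rfl

variable (D M) in
/-- The canonical map from the columns with entries in the corner of `M` to `M`. -/
def fromCol : D.Col (D.Corner M) →ₗ[D.Lambda] M where
  toFun v := ∑ i, D.col i • (v i : M)
  map_add' v w := by
    simp only [Col.add_apply, AddSubgroup.coe_add, smul_add, Finset.sum_add_distrib]
  map_smul' r v := by
    simp only [Col.smul_apply, AddSubgroup.val_finsetSum, coe_corner_smul, Finset.smul_sum,
      RingHom.id_apply]
    rw [Finset.sum_comm]
    refine Finset.sum_congr rfl fun j _ => ?_
    rw [smul_smul r, mul_col, Finset.sum_smul]
    simp only [smul_smul]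

theorem fromCol_apply (v : D.Col (D.Corner M)) :
    fromCol D M v = ∑ i, D.col i • (v i : M) := rfl

theorem idem_smul_fromCol (k : Fin (m + 1)) (v : D.Col (D.Corner M)) :
    D.idem k • fromCol D M v = D.col k • (v k : M) := by
  rw [fromCol_apply, Finset.smul_sum, Finset.sum_eq_single k]
  · rw [smul_smul, idem_mul_col]
  · intro j _ hj
    rw [smul_smul, idem_mul_col_of_ne _ hj.symm, zero_smul]
  · simp

variable {N : Type u} [AddCommGroup N] [Module A N]

/-- The map on corners induced by a linear map to a module of columns. -/
def cornerMap (f : M →ₗ[D.Lambda] D.Col N) : D.Corner M →ₗ[A] N where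
  toFun x := f x 0
  map_add' x y := by simp [Col.add_apply]
  map_smul' a x := by
    rw [coe_corner_smul, map_smul, corner, Col.single_smul_apply, if_pos rfl, RingHom.id_apply]

theorem cornerMap_apply (f : M →ₗ[D.Lambda] D.Col N) (x : D.Corner M) :
    cornerMap f x = f x 0 := rfl

/-- A section on corners extends to a section on columns, because columns are generated by their
corner. -/
theorem fromCol_cornerMap (f : M →ₗ[D.Lambda] D.Col N) (h : N →ₗ[A] D.Corner M)
    (hf : ∀ y, cornerMap f (h y) = y) (v : D.Col N) :
    f (fromCol D M (Col.map h v)) = v := by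
  rw [fromCol_apply, map_sum]
  funext l
  rw [Col.sum_apply, Finset.sum_eq_single l]
  · rw [map_smul, col, Col.single_smul_apply, if_pos rfl, one_smul]
    exact hf (v l)
  · intro j _ hj
    rw [map_smul, col, Col.single_smul_apply, if_neg hj]
  · simp

theorem projective_col [Module.Projective A N] : Module.Projective D.Lambda (D.Col N) := by
  refine Module.Projective.of_lifting_property'' fun f hf => ?_
  have hs : Function.Surjective (cornerMap f) := fun y => by
    let c : D.Col N := fun _ => y
    obtain ⟨x, hx⟩ := hf c
    refine ⟨⟨_, col_zero_smul_mem_corner x⟩, ?_⟩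
    rw [cornerMap_apply, map_smul, hx, col, Col.single_smul_apply, if_pos rfl, one_smul]
  obtain ⟨h, hh⟩ := Module.projective_lifting_property (cornerMap f) LinearMap.id hs
  exact ⟨fromCol D _ ∘ₗ Col.map h, LinearMap.ext fun v =>
    fromCol_cornerMap f h (fun y => LinearMap.congr_fun hh y) v⟩

/-- N is the corner of its column module: a Λ-linear section of the induced column map, restricted
to columns supported in position 0 and read off there, is an A-linear section. -/
theorem projective_of_projective_col [Module.Projective D.Lambda (D.Col N)] :
    Module.Projective A N := by
  refine Module.Projective.of_lifting_property'' fun f hf => ?_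
  obtain ⟨h, hh⟩ := Module.projective_lifting_property (Col.map (D := D) f) LinearMap.id
    (Col.map_surjective hf)
  have hs (v : D.Col N) (i : Fin (m + 1)) : f (h v i) = v i :=
    congrFun (LinearMap.congr_fun hh v) i
  let e : N → D.Col N := fun y => fun i => if i = 0 then y else 0
  have he (y : N) : e y 0 = y := if_pos rfl
  have he_smul (a : A) (y : N) : e (a • y) = D.corner a • e y := by
    funext i
    rw [corner, Col.single_smul_apply, he]
    by_cases hi : i = 0
    · simp [e, hi]
    · simp [e, hi, Ne.symm hi]
  have he_add (x y : N) : e (x + y) = e x + e y := by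
    funext i
    rw [Col.add_apply]
    by_cases hi : i = 0 <;> simp [e, hi]
  refine ⟨⟨⟨fun y => h (e y) 0, fun x y => ?_⟩, fun a y => ?_⟩, LinearMap.ext fun y => ?_⟩
  · rw [he_add, map_add, Col.add_apply]
  · simp only [he_smul, map_smul, RingHom.id_apply]
    rw [corner, Col.single_smul_apply, if_pos rfl]
  · exact (hs _ _).trans (he y)

end Corner

/-- Exactness and preservation of projectives allow dimension shifting; reflection of projectives
gives the converse below. -/
theorem hasProjDimLE_col {n : ℕ} : ∀ {N : Type u} [AddCommGroup N] [Module A N],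
    HasProjDimLE A N n → HasProjDimLE D.Lambda (D.Col N) n := by
  induction n with
  | zero =>
    intro N _ _ h
    have := hasProjDimLE_zero_iff.1 h
    exact hasProjDimLE_zero_iff.2 projective_col
  | succ n ih =>
    intro N _ _ h
    obtain ⟨P, _, _, g, _, hg⟩ := exists_projective_surjective A N
    have := projective_col (D := D) (N := P)
    exact (ih (h.ker hg)).right (Module.Projective.hasProjDimLE _)
      (Col.map_injective (LinearMap.ker g).injective_subtype)
      (Col.map_exact (LinearMap.exact_subtype_ker_map g)) (Col.map_surjective hg)

theorem hasProjDimLE_of_col {n : ℕ} : ∀ {N : Type u} [AddCommGroup N] [Module A N],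
    HasProjDimLE D.Lambda (D.Col N) n → HasProjDimLE A N n := by
  induction n with
  | zero =>
    intro N _ _ h
    have := hasProjDimLE_zero_iff.1 h
    exact hasProjDimLE_zero_iff.2 (projective_of_projective_col (D := D))
  | succ n ih =>
    intro N _ _ h
    obtain ⟨P, _, _, g, _, hg⟩ := exists_projective_surjective A N
    have := projective_col (D := D) (N := P)
    exact HasProjDimLE.of_ker hg (ih ((Module.Projective.hasProjDimLE _).left h
      (Col.map_injective (LinearMap.ker g).injective_subtype)
      (Col.map_exact (LinearMap.exact_subtype_ker_map g)) (Col.map_surjective hg)))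
      (Module.Projective.hasProjDimLE _)

end MatrixSubringData

/-! ### Restriction of scalars and semilinear maps -/

section Inflate

variable {R S : Type u} [Ring R] [Ring S] (π : R →+* S)

/-- The restriction of scalars of an `S`-module along a ring homomorphism `π : R → S`. -/
def Inflate (_ : R →+* S) (X : Type u) : Type u := X

variable {π} {X Y M : Type u} [AddCommGroup X] [Module S X] [AddCommGroup Y] [Module S Y]
  [AddCommGroup M] [Module R M]

instance : AddCommGroup (Inflate π X) := inferInstanceAs (AddCommGroup X)

instance : Module R (Inflate π X) := Module.compHom X π

/-- A semilinear map as a linear map to the restriction of scalars. -/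
def Inflate.ofSemilinear (p : M →ₛₗ[π] X) : M →ₗ[R] Inflate π X where
  toFun := p
  map_add' := p.map_add
  map_smul' := p.map_smulₛₗ

/-- A linear map to the restriction of scalars as a semilinear map. -/
def Inflate.toSemilinear (p : M →ₗ[R] Inflate π X) : M →ₛₗ[π] X where
  toFun := p
  map_add' := p.map_add
  map_smul' := p.map_smul

/-- The restriction of scalars of a linear map. -/
def Inflate.map (f : X →ₗ[S] Y) : Inflate π X →ₗ[R] Inflate π Y where
  toFun := f
  map_add' := f.map_add
  map_smul' r x := f.map_smul (π r) x

theorem exists_linearMap_of_semilinear (hπ : Function.Surjective π) {p : M →ₛₗ[π] X}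
    (hp : Function.Surjective p) {h : M →ₛₗ[π] Y} (hph : ∀ x, p x = 0 → h x = 0) :
    ∃ q : X →ₗ[S] Y, ∀ x, q (p x) = h x := by
  have key {x y : M} (e : p x = p y) : h x = h y := by
    rw [← sub_eq_zero, ← map_sub]
    exact hph _ (by rw [map_sub, e, sub_self])
  have hs := Function.surjInv_eq hp
  refine ⟨⟨⟨fun y => h (Function.surjInv hp y), fun y z => ?_⟩, fun s y => ?_⟩, fun x => ?_⟩
  · rw [← map_add]
    exact key (by rw [map_add, hs, hs, hs])
  · obtain ⟨r, rfl⟩ := hπ s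
    simp only [RingHom.id_apply]
    rw [← map_smulₛₗ]
    exact key (by rw [map_smulₛₗ, hs, hs])
  · exact key (hs _)

end Inflate

theorem Module.Projective.finsupp (ι : Type*) {R M : Type*} [Ring R] [AddCommGroup M] [Module R M]
    [Module.Projective R M] : Module.Projective R (ι →₀ M) := by
  classical
  exact Module.Projective.of_equiv (finsuppLequivDFinsupp (M := M) (ι := ι) R).symm

/-! ### Admissible modules and their projective covers -/

namespace MatrixSubringData

variable {A : Type u} [Ring A] {m : ℕ} (D : MatrixSubringData A m)

theorem mem_entry_iff_of_lt {i : Fin (m + 1)} {j : Fin m} (h : i < j.succ) (a : A) :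
    a ∈ D.entry i j.succ ↔ a ∈ D.I j := by
  induction i using Fin.cases with
  | zero => exact D.mem_entry_zero_succ j a
  | succ i => exact D.mem_entry_of_lt (Fin.succ_lt_succ_iff.1 h) a

/-- Left multiplication by e_i0 copies row 0 into row i without loss. Hence Λ and its left ideals
satisfy the injectivity half of admissibility. -/
theorem col_zero_mul_eq_zero {i : Fin (m + 1)} {r : D.Lambda} (h : D.col i * r = 0) :
    D.col 0 * r = 0 := by
  refine Subtype.ext (Matrix.ext fun l j => ?_)
  have h : (Matrix.single i 0 1 * r.1 : Matrix (Fin (m + 1)) (Fin (m + 1)) A) i j = 0 :=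
    congrFun (congrFun (congrArg Subtype.val h) i) j
  change (Matrix.single 0 0 1 * r.1 : Matrix (Fin (m + 1)) (Fin (m + 1)) A) l j = 0
  rw [Matrix.single_mul_apply_same, one_mul] at h
  by_cases hl : l = 0
  · subst hl
    rw [Matrix.single_mul_apply_same, one_mul, h]
  · rw [Matrix.single_mul_apply_of_ne _ _ _ _ _ hl]

/-- The `Λ`-module `M` is torsion-free with respect to the first column, and for `i < n` its
component in position `i` comes from the first column. -/
structure Admissible (n : ℕ) (M : Type u) [AddCommGroup M] [Module D.Lambda M] : Prop where
  col_zero_smul : ∀ i (x : M), D.col i • x = 0 → D.col 0 • x = 0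
  exists_col_smul : ∀ i : Fin (m + 1), i.1 < n → ∀ x : M, ∃ y : M, D.idem i • x = D.col i • y

/-- The components of the `Λ`-module `M` in positions `i < n` vanish. -/
def IsBelow (n : ℕ) (M : Type u) [AddCommGroup M] [Module D.Lambda M] : Prop :=
  ∀ i : Fin (m + 1), i.1 < n → ∀ x : M, D.idem i • x = 0

section Admissible

variable {D} {M N : Type u} [AddCommGroup M] [Module D.Lambda M] [AddCommGroup N]
  [Module D.Lambda N]

theorem IsBelow.admissible {n : ℕ} (h : D.IsBelow (n + 1) M) : D.Admissible (n + 1) M :=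
  ⟨fun _ x _ => h 0 n.succ_pos x, fun i hi x => ⟨0, by rw [h i hi, smul_zero]⟩⟩

theorem IsBelow.col_smul {n : ℕ} (h : D.IsBelow (n + 1) M) (i : Fin (m + 1)) (x : M) :
    D.col i • x = 0 := by
  rw [← D.col_mul_col_zero, mul_smul, ← D.idem_zero, h 0 n.succ_pos x, smul_zero]

/-- If e_ii x = e_i0 y with x in the kernel, then e_i0 kills g y, so injectivity in the target puts
e_00 y in the kernel, and e_00 y serves in place of y. -/
theorem Admissible.ker {n : ℕ} (hM : D.Admissible n M) (hN : D.Admissible n N)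
    (g : M →ₗ[D.Lambda] N) : D.Admissible n (LinearMap.ker g) where
  col_zero_smul i x hx := Subtype.ext (hM.col_zero_smul i x (congrArg Subtype.val hx))
  exists_col_smul i hi x := by
    obtain ⟨y, hy⟩ := hM.exists_col_smul i hi x
    have hgy : D.col 0 • g y = 0 := hN.col_zero_smul i _ (by
      rw [← map_smul, ← hy, map_smul, x.2, smul_zero])
    refine ⟨⟨D.col 0 • y, by rw [LinearMap.mem_ker, map_smul, hgy]⟩, Subtype.ext ?_⟩
    change D.idem i • (x : M) = D.col i • D.col 0 • y
    rw [smul_smul, col_mul_col_zero, hy]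

theorem Admissible.finsupp {n : ℕ} (hM : D.Admissible n M) (ι : Type u) :
    D.Admissible n (ι →₀ M) where
  col_zero_smul i x hx := Finsupp.ext fun a =>
    hM.col_zero_smul i (x a) (DFunLike.congr_fun hx a)
  exists_col_smul i hi x := by
    induction x using Finsupp.induction_linear with
    | zero => exact ⟨0, by simp⟩
    | add x x' h h' =>
      obtain ⟨y, hy⟩ := h
      obtain ⟨y', hy'⟩ := h'
      exact ⟨y + y', by rw [smul_add, smul_add, hy, hy']⟩
    | single a x =>
      obtain ⟨y, hy⟩ := hM.exists_col_smul i hi x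
      exact ⟨Finsupp.single a y, by rw [Finsupp.smul_single, Finsupp.smul_single, hy]⟩

variable (D) in
/-- The left ideal of matrices in `Λ` whose columns in positions `0 < j < n` vanish. -/
def outerColumns (n : ℕ) : Submodule D.Lambda D.Lambda where
  carrier := {r | ∀ i j, j ≠ 0 → j.1 < n → r.1 i j = 0}
  zero_mem' _ _ _ _ := rfl
  add_mem' {r s} hr hs i j h0 hj := by
    change r.1 i j + s.1 i j = 0
    rw [hr i j h0 hj, hs i j h0 hj, add_zero]
  smul_mem' r s hs i j h0 hj := by
    change (r.1 * s.1) i j = 0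
    rw [Matrix.mul_apply]
    exact Finset.sum_eq_zero fun l _ => by rw [hs l j h0 hj, mul_zero]

theorem single_mem_outerColumns {n : ℕ} {i j : Fin (m + 1)} {a : A} (ha : a ∈ D.entry i j)
    (hj : j ≠ 0 → n ≤ j.1) : D.single i j a ha ∈ D.outerColumns n := by
  intro i' j' h0 hj'
  refine Matrix.single_apply_of_ne _ _ _ _ _ ?_
  rintro ⟨rfl, rfl⟩
  have := hj h0
  omega

/-- Right multiplication by a diagonal idempotent of Λ splits off this left ideal. -/
instance projective_outerColumns (n : ℕ) : Module.Projective D.Lambda (D.outerColumns n) := by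
  let g : D.Lambda := ⟨Matrix.diagonal fun j => if j ≠ 0 ∧ j.1 < n then 0 else 1, fun i j => by
    rw [Matrix.diagonal_apply]
    split_ifs with h
    · exact zero_mem _
    · subst h
      exact D.one_mem_entry i
    · exact zero_mem _⟩
  have hg (r : D.Lambda) (i j : Fin (m + 1)) :
      (r * g).1 i j = if j ≠ 0 ∧ j.1 < n then 0 else r.1 i j := by
    change (r.1 * Matrix.diagonal _ : Matrix (Fin (m + 1)) (Fin (m + 1)) A) i j = _
    rw [Matrix.mul_diagonal, mul_ite, mul_zero, mul_one]
  refine Module.Projective.of_split (D.outerColumns n).subtype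
    ((LinearMap.toSpanSingleton D.Lambda D.Lambda g).codRestrict _
      fun r i j h0 hj => (hg r i j).trans (if_pos ⟨h0, hj⟩))
    (LinearMap.ext fun r => Subtype.ext (Subtype.ext (Matrix.ext fun i j => ?_)))
  refine (hg r i j).trans ?_
  split_ifs with h
  · exact (r.2 i j h.1 h.2).symm
  · rfl

/-- Row i < n can be moved up to row 0: only column 0 and columns j ≥ n > i survive, and there rows
0 and i have the same entry sets, A and the ideal of that column. -/
theorem admissible_outerColumns (n : ℕ) : D.Admissible n (D.outerColumns n) where
  col_zero_smul i x hx := by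
    exact Subtype.ext (D.col_zero_mul_eq_zero (congrArg Subtype.val hx))
  exists_col_smul i hi x := by
    by_cases h0 : i = 0
    · subst h0
      exact ⟨x, rfl⟩
    refine ⟨⟨⟨Matrix.of fun l j => if l = 0 then x.1.1 i j else 0, fun l j => ?_⟩,
      fun l j hj0 hj => ?_⟩, Subtype.ext (Subtype.ext (Matrix.ext fun l j => ?_))⟩
    · rw [Matrix.of_apply]
      split_ifs with hl
      · subst hl
        induction j using Fin.cases with
        | zero => exact D.mem_entry_zero _ _
        | succ j =>
          by_cases hj : j.succ.1 < n
          · rw [x.2 i j.succ (Fin.succ_ne_zero j) hj]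
            exact zero_mem _
          · rw [mem_entry_zero_succ]
            exact (D.mem_entry_iff_of_lt (Fin.lt_def.2 (by omega)) _).1 (x.1.2 i j.succ)
      · exact zero_mem _
    · change (if l = 0 then x.1.1 i j else 0) = 0
      rw [x.2 i j hj0 hj, ite_self]
    · change (Matrix.single i i 1 * x.1.1 : Matrix (Fin (m + 1)) (Fin (m + 1)) A) l j =
        (Matrix.single i 0 1 * Matrix.of _ : Matrix (Fin (m + 1)) (Fin (m + 1)) A) l j
      by_cases hl : l = i
      · subst hl
        rw [Matrix.single_mul_apply_same, Matrix.single_mul_apply_same]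
        rfl
      · rw [Matrix.single_mul_apply_of_ne _ _ _ _ _ hl,
          Matrix.single_mul_apply_of_ne _ _ _ _ _ hl]

/-- Copies of `outerColumns n` suffice: components in positions i < n are reached through e_i0, the
others through e_ii, and both matrices lie in this left ideal. -/
theorem Admissible.exists_projective_surjective {n : ℕ} (hM : D.Admissible n M) :
    ∃ (P : Type u) (_ : AddCommGroup P) (_ : Module D.Lambda P) (g : P →ₗ[D.Lambda] M),
      Module.Projective D.Lambda P ∧ D.Admissible n P ∧ Function.Surjective g := by
  let g : (M →₀ D.outerColumns n) →ₗ[D.Lambda] M := Finsupp.lsum ℕ fun x =>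
    LinearMap.toSpanSingleton D.Lambda M x ∘ₗ (D.outerColumns n).subtype
  have hg (x : M) (r : D.outerColumns n) : g (Finsupp.single x r) = r.1 • x := by
    simp [g]
  refine ⟨_, inferInstance, inferInstance, g, Module.Projective.finsupp M,
    (admissible_outerColumns n).finsupp M, LinearMap.range_eq_top.1 (eq_top_iff.2 fun x _ => ?_)⟩
  rw [← D.sum_idem_smul x]
  refine Submodule.sum_mem _ fun i _ => ?_
  by_cases hi : i.1 < n
  · obtain ⟨y, hy⟩ := hM.exists_col_smul i hi x
    rw [hy]
    exact ⟨_, hg y ⟨D.col i, single_mem_outerColumns _ fun h => absurd rfl h⟩⟩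
  · exact ⟨_, hg x ⟨D.idem i, single_mem_outerColumns _ fun _ => not_lt.1 hi⟩⟩

end Admissible

/-! ### Diagonal quotients and tops of admissible modules -/

/-- The ring homomorphism from `Λ` to `A_k / I_k` given by the `k`-th diagonal entry. -/
def diag (k : Fin m) : D.Lambda →+* D.DiagQuotient k where
  toFun r := Ideal.Quotient.mk _ ⟨r.1 k.succ k.succ, (D.mem_entry_diag k _).1 (r.2 _ _)⟩
  map_one' := by
    rw [← map_one (Ideal.Quotient.mk _)]
    exact congrArg _ (Subtype.ext (Matrix.one_apply_eq _))
  map_zero' := by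
    rw [← map_zero (Ideal.Quotient.mk _)]
    rfl
  map_add' r s := by
    rw [← map_add (Ideal.Quotient.mk _)]
    rfl
  map_mul' r s := by
    rw [← map_mul (Ideal.Quotient.mk _), Ideal.Quotient.mk_eq_mk_iff_sub_mem, Ideal.mem_comap]
    change (r.1 * s.1) k.succ k.succ - r.1 k.succ k.succ * s.1 k.succ k.succ ∈ D.I k
    rw [Matrix.mul_apply, ← Finset.add_sum_erase _ _ (Finset.mem_univ k.succ),
      add_sub_cancel_left]
    refine Submodule.sum_mem _ fun j hj => ?_
    -- Left of the diagonal position the right factor lies in I_k; beyond it the left factor lies in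
    -- a later ideal, contained in I_k.
    rcases lt_or_gt_of_ne (Finset.ne_of_mem_erase hj) with h | h
    · exact (D.I k).mul_mem_left _ ((D.mem_entry_iff_of_lt h _).1 (s.2 j k.succ))
    · obtain ⟨j, rfl⟩ := Fin.exists_succ_eq.2 (Fin.ne_zero_of_lt h)
      exact (D.I k).mul_mem_right _ (D.I_anti k j (Fin.succ_le_succ_iff.1 h.le)
        ((D.mem_entry_iff_of_lt h _).1 (r.2 k.succ j.succ)))

theorem diag_apply (k : Fin m) (r : D.Lambda) : D.diag k r =
    Ideal.Quotient.mk _ ⟨r.1 k.succ k.succ, (D.mem_entry_diag k _).1 (r.2 _ _)⟩ := rfl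

theorem diag_eq_zero_iff (k : Fin m) (r : D.Lambda) :
    D.diag k r = 0 ↔ r.1 k.succ k.succ ∈ D.I k := by
  rw [diag_apply, Ideal.Quotient.eq_zero_iff_mem, Ideal.mem_comap]
  rfl

theorem diag_surjective (k : Fin m) : Function.Surjective (D.diag k) := by
  intro s
  obtain ⟨b, rfl⟩ := Ideal.Quotient.mk_surjective s
  refine ⟨D.single k.succ k.succ b ((D.mem_entry_diag k _).2 b.2), ?_⟩
  rw [diag_apply]
  exact congrArg _ (Subtype.ext (Matrix.single_apply_same _ _ _))

theorem diag_idem (k : Fin m) : D.diag k (D.idem k.succ) = 1 := by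
  rw [diag_apply, ← map_one (Ideal.Quotient.mk _)]
  exact congrArg _ (Subtype.ext (Matrix.single_apply_same _ _ _))

theorem diag_idem_of_ne {k : Fin m} {i : Fin (m + 1)} (h : i ≠ k.succ) :
    D.diag k (D.idem i) = 0 := by
  rw [diag_eq_zero_iff]
  have : (D.idem i).1 k.succ k.succ = 0 := Matrix.single_apply_of_ne _ _ _ _ _ (by tauto)
  rw [this]
  exact zero_mem _

theorem diag_col (k : Fin m) (i : Fin (m + 1)) : D.diag k (D.col i) = 0 := by
  rw [diag_eq_zero_iff]
  have : (D.col i).1 k.succ k.succ = 0 :=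
    Matrix.single_apply_of_ne _ _ _ _ _ fun h => Fin.succ_ne_zero k h.2.symm
  rw [this]
  exact zero_mem _

section Top

variable {D} {k : Fin m} {M N X Y : Type u} [AddCommGroup M] [Module D.Lambda M] [AddCommGroup N]
  [Module D.Lambda N] [AddCommGroup X] [Module (D.DiagQuotient k) X]
  [AddCommGroup Y] [Module (D.DiagQuotient k) Y]

/-- Modulo the first column only the diagonal entry of r acts. Earlier positions of x already come
from the first column; later entries of the row lie in an ideal I_j, so they may be moved to row 0
and brought back by e_i0. -/
theorem Admissible.exists_idem_smul_smul (hM : D.Admissible (k + 1) M) (r : D.Lambda) (x : M) :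
    ∃ y, D.idem k.succ • r • x =
      D.single k.succ k.succ (r.1 k.succ k.succ) (r.2 _ _) • x + D.col k.succ • y := by
  have key (j : Fin (m + 1)) (hj : j ≠ k.succ) :
      ∃ y, D.single k.succ j (r.1 k.succ j) (r.2 _ _) • x = D.col k.succ • y := by
    rcases lt_or_gt_of_ne hj with h | h
    · obtain ⟨y, hy⟩ := hM.exists_col_smul j (by simpa [Fin.lt_def] using h) x
      refine ⟨D.corner (r.1 k.succ j) • y, ?_⟩
      rw [← single_mul_idem, mul_smul, hy, smul_smul, smul_smul, single_mul_col]
    · obtain ⟨j, rfl⟩ := Fin.exists_succ_eq.2 (Fin.ne_zero_of_lt h)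
      have ha : r.1 k.succ j.succ ∈ D.entry 0 j.succ :=
        (D.mem_entry_zero_succ j _).2 ((D.mem_entry_iff_of_lt h _).1 (r.2 _ _))
      exact ⟨D.single 0 j.succ _ ha • x, by rw [smul_smul, col_mul_single]⟩
  choose y hy using key
  refine ⟨∑ j ∈ (Finset.univ.erase k.succ).attach, y j (Finset.ne_of_mem_erase j.2), ?_⟩
  rw [idem_smul_smul, ← Finset.add_sum_erase _ _ (Finset.mem_univ k.succ), Finset.smul_sum,
    ← Finset.sum_attach (Finset.univ.erase k.succ)]
  simp only [← hy]

/-- The submodule of `M` of elements whose component in position `k` comes from the first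
column. -/
def Admissible.colSubmodule (hM : D.Admissible (k + 1) M) : Submodule D.Lambda M where
  carrier := {x | ∃ y : M, D.idem k.succ • x = D.col k.succ • y}
  zero_mem' := ⟨0, by rw [smul_zero, smul_zero]⟩
  add_mem' := by
    rintro x x' ⟨y, hy⟩ ⟨y', hy'⟩
    exact ⟨y + y', by rw [smul_add, smul_add, hy, hy']⟩
  smul_mem' := by
    rintro r x ⟨y, hy⟩
    obtain ⟨z, hz⟩ := hM.exists_idem_smul_smul r x
    refine ⟨D.corner (r.1 k.succ k.succ) • y + z, ?_⟩
    rw [hz, smul_add, ← single_mul_idem, mul_smul, hy, smul_smul, smul_smul, single_mul_col]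

/-- The semilinear map `p` exhibits the `A_k / I_k`-module `X` as the quotient of the component of
`M` in position `k` by the part that comes from the first column. -/
structure IsTop (p : M →ₛₗ[D.diag k] X) : Prop where
  surjective : Function.Surjective p
  eq_zero_iff : ∀ x, p x = 0 ↔ ∃ y : M, D.idem k.succ • x = D.col k.succ • y

theorem semilinear_idem_smul (p : M →ₛₗ[D.diag k] X) (x : M) : p (D.idem k.succ • x) = p x := by
  rw [map_smulₛₗ, diag_idem, one_smul]

theorem semilinear_col_smul (p : M →ₛₗ[D.diag k] X) (i : Fin (m + 1)) (x : M) :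
    p (D.col i • x) = 0 := by
  rw [map_smulₛₗ, diag_col, zero_smul]

theorem IsTop.eq_zero_of_eq_zero {p : M →ₛₗ[D.diag k] X} (hp : IsTop p) (h : M →ₛₗ[D.diag k] Y)
    (x : M) (hx : p x = 0) : h x = 0 := by
  obtain ⟨y, hy⟩ := (hp.eq_zero_iff x).1 hx
  rw [← semilinear_idem_smul, hy, semilinear_col_smul]

/-- The quotient by `colSubmodule` is killed by ker(`diag k`): a diagonal entry in I_k also fits in
row 0, so its action factors through the first column. -/
theorem Admissible.exists_isTop (hM : D.Admissible (k + 1) M) :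
    ∃ (X : Type u) (_ : AddCommGroup X) (_ : Module (D.DiagQuotient k) X)
      (p : M →ₛₗ[D.diag k] X), IsTop p := by
  let Y := M ⧸ hM.colSubmodule
  have hY (r : D.Lambda) (hr : D.diag k r = 0) (y : Y) : r • y = 0 := by
    obtain ⟨x, rfl⟩ := Submodule.mkQ_surjective _ y
    rw [← map_smul, Submodule.mkQ_apply, Submodule.Quotient.mk_eq_zero]
    obtain ⟨z, hz⟩ := hM.exists_idem_smul_smul r x
    rw [diag_eq_zero_iff] at hr
    refine ⟨D.single 0 k.succ _ ((D.mem_entry_zero_succ k _).2 hr) • x + z, ?_⟩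
    rw [hz, smul_add, smul_smul, col_mul_single]
  let := moduleOfSurjective (D.diag k) (D.diag_surjective k) Y hY
  refine ⟨Y, inferInstance, inferInstance,
    ⟨⟨hM.colSubmodule.mkQ, map_add _⟩, fun r x => ?_⟩,
    ⟨Submodule.mkQ_surjective _, fun x => Submodule.Quotient.mk_eq_zero _⟩⟩
  exact (map_smul _ r x).trans
    (smul_eq_moduleOfSurjective_smul (D.diag k) (D.diag_surjective k) Y hY r _)

theorem isBelow_inflate : D.IsBelow (k + 1) (Inflate (D.diag k) X) := fun i hi x => by
  have hi' : i ≠ k.succ := by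
    rintro rfl
    simp at hi
  change D.diag k (D.idem i) • (show X from x) = 0
  rw [diag_idem_of_ne _ hi', zero_smul]

end Top

end MatrixSubringData

namespace MatrixSubringData

variable {A : Type u} [Ring A] {m : ℕ} {D : MatrixSubringData A m}

/-! ### The lower bound -/

section LowerBound

variable {k : Fin m} {M X : Type u} [AddCommGroup M] [Module D.Lambda M] [AddCommGroup X]
  [Module (D.DiagQuotient k) X]

/-- Left adjoints of exact functors preserve projectives: lift M → X through the inflated
surjection, then factor the lift through the top. -/
theorem IsTop.projective [Module.Projective D.Lambda M] {p : M →ₛₗ[D.diag k] X} (hp : IsTop p) :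
    Module.Projective (D.DiagQuotient k) X := by
  refine Module.Projective.of_lifting_property'' fun f hf => ?_
  obtain ⟨h, hh⟩ := Module.projective_lifting_property (Inflate.map (π := D.diag k) f)
    (Inflate.ofSemilinear p) hf
  obtain ⟨q, hq⟩ := exists_linearMap_of_semilinear (D.diag_surjective k) hp.surjective
    (hp.eq_zero_of_eq_zero (Inflate.toSemilinear h))
  refine ⟨q, LinearMap.ext fun x => ?_⟩
  obtain ⟨y, rfl⟩ := hp.surjective x
  change f (q (p y)) = p y
  rw [hq]
  exact LinearMap.congr_fun hh y

/-- Dimension shifting along an admissible projective cover P → M. Its kernel is admissible, and the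
top of the kernel is the kernel of the map on tops, by a snake-lemma argument using that e_i0 is
injective on the corner of M. -/
theorem IsTop.hasProjDimLE {n : ℕ} : ∀ {M X : Type u} [AddCommGroup M] [Module D.Lambda M]
    [AddCommGroup X] [Module (D.DiagQuotient k) X] {p : M →ₛₗ[D.diag k] X},
    D.Admissible (k + 1) M → IsTop p → HasProjDimLE D.Lambda M n →
    HasProjDimLE (D.DiagQuotient k) X n := by
  induction n with
  | zero =>
    intro M X _ _ _ _ p hM hp h
    have := hasProjDimLE_zero_iff.1 h
    exact hasProjDimLE_zero_iff.2 hp.projective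
  | succ n ih =>
    intro M X _ _ _ _ p hM hp h
    obtain ⟨P, _, _, g, _, hP, hg⟩ := hM.exists_projective_surjective
    obtain ⟨T, _, _, t, ht⟩ := hP.exists_isTop
    obtain ⟨q, hq⟩ := exists_linearMap_of_semilinear (D.diag_surjective k) ht.surjective
      (ht.eq_zero_of_eq_zero (p.comp g))
    replace hq (x : P) : q (t x) = p (g x) := hq x
    have hq_surj : Function.Surjective q := fun x => by
      obtain ⟨y, rfl⟩ := hp.surjective x
      obtain ⟨z, rfl⟩ := hg y
      exact ⟨t z, hq z⟩
    have := ht.projective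
    let s : LinearMap.ker g →ₛₗ[D.diag k] LinearMap.ker q :=
      (t.comp (LinearMap.ker g).subtype).codRestrict (LinearMap.ker q) fun x => by
        change q (t x) = 0
        rw [hq, x.2, map_zero]
    refine HasProjDimLE.of_ker hq_surj (ih (p := s) (hP.ker hM g) ⟨?_, fun x => ?_⟩ (h.ker hg))
      (Module.Projective.hasProjDimLE _)
    · rintro ⟨y, hy⟩
      obtain ⟨x, rfl⟩ := ht.surjective y
      rw [LinearMap.mem_ker, hq, hp.eq_zero_iff] at hy
      obtain ⟨z, hz⟩ := hy
      obtain ⟨w, rfl⟩ := hg z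
      -- Subtracting a first-column element moves the lift into ker g without changing its class in
      -- the top.
      refine ⟨⟨D.idem k.succ • x - D.col k.succ • w, ?_⟩, Subtype.ext ?_⟩
      · rw [LinearMap.mem_ker, map_sub, map_smul, map_smul, hz, sub_self]
      · change t (D.idem k.succ • x - D.col k.succ • w) = t x
        rw [map_sub, semilinear_idem_smul, semilinear_col_smul, sub_zero]
    · have h0 : s x = 0 ↔ t (x : P) = 0 := Subtype.ext_iff
      rw [h0, ht.eq_zero_iff]
      constructor
      · rintro ⟨y, hy⟩
        have hgy : D.col 0 • g y = 0 := hM.col_zero_smul k.succ _ (by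
          rw [← map_smul, ← hy, map_smul, x.2, smul_zero])
        refine ⟨⟨D.col 0 • y, by rw [LinearMap.mem_ker, map_smul, hgy]⟩, Subtype.ext ?_⟩
        change D.idem k.succ • (x : P) = D.col k.succ • D.col 0 • y
        rw [smul_smul, col_mul_col_zero, hy]
      · rintro ⟨y, hy⟩
        exact ⟨y, congrArg Subtype.val hy⟩

theorem hasProjDimLE_of_inflate {n : ℕ} (h : HasProjDimLE D.Lambda (Inflate (D.diag k) X) n) :
    HasProjDimLE (D.DiagQuotient k) X n := by
  let p : Inflate (D.diag k) X →ₛₗ[D.diag k] X := Inflate.toSemilinear LinearMap.id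
  have hp : IsTop p := ⟨fun x => ⟨x, rfl⟩, fun x =>
    ⟨fun hx => ⟨0, by rw [show x = 0 from hx, smul_zero, smul_zero]⟩, fun ⟨y, hy⟩ => by
      rw [← semilinear_idem_smul, hy, semilinear_col_smul]⟩⟩
  exact hp.hasProjDimLE isBelow_inflate.admissible h

theorem leftGlobalDimension_le_of_lambda {n : ℕ} (h : leftGlobalDimension D.Lambda ≤ n) :
    leftGlobalDimension A ≤ n ∧ ∀ k, leftGlobalDimension (D.DiagQuotient k) ≤ n := by
  rw [leftGlobalDimension_le_iff] at h
  refine ⟨(leftGlobalDimension_le_iff A).2 fun N _ _ => hasProjDimLE_of_col D (h _), fun k =>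
    (leftGlobalDimension_le_iff _).2 fun X _ _ => hasProjDimLE_of_inflate (h _)⟩

end LowerBound

/-! ### The upper bound -/

section UpperBound

variable {M : Type u} [AddCommGroup M] [Module D.Lambda M]

theorem Admissible.fromCol_injective {n : ℕ} (hM : D.Admissible n M) :
    Function.Injective (fromCol D M) := by
  rw [← LinearMap.ker_eq_bot, LinearMap.ker_eq_bot']
  intro v hv
  refine funext fun k => Subtype.ext ?_
  have h := idem_smul_fromCol k v
  rw [hv, smul_zero] at h
  exact (v k).2.symm.trans (hM.col_zero_smul k _ h.symm)

theorem col_smul_mem_range (i : Fin (m + 1)) (y : M) :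
    D.col i • y ∈ LinearMap.range (fromCol D M) := by
  let v : D.Col (D.Corner M) := fun l =>
    if l = i then ⟨_, col_zero_smul_mem_corner y⟩ else 0
  refine ⟨v, ?_⟩
  rw [fromCol_apply, Finset.sum_eq_single i]
  · rw [show v i = _ from if_pos rfl, smul_smul, col_mul_col_zero]
  · intro j _ hj
    rw [show v j = 0 from if_neg hj, AddSubgroup.coe_zero, smul_zero]
  · simp

/-- M is an extension of a module supported in positions ≥ n by the columns over its corner, and the
columns are controlled by A. -/
theorem Admissible.hasProjDimLE {n b : ℕ} (hM : D.Admissible n M)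
    (hA : leftGlobalDimension A ≤ b)
    (hb : ∀ (N : Type u) [AddCommGroup N] [Module D.Lambda N], D.IsBelow n N →
      HasProjDimLE D.Lambda N b) : HasProjDimLE D.Lambda M b := by
  refine (hasProjDimLE_col D ((leftGlobalDimension_le_iff A).1 hA _)).middle
    (hb (M ⧸ LinearMap.range (fromCol D M)) fun i hi x => ?_) hM.fromCol_injective
    (LinearMap.exact_map_mkQ_range _) (Submodule.mkQ_surjective _)
  obtain ⟨x, rfl⟩ := Submodule.mkQ_surjective _ x
  obtain ⟨y, hy⟩ := hM.exists_col_smul i hi x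
  rw [← map_smul, Submodule.mkQ_apply, Submodule.Quotient.mk_eq_zero, hy]
  exact col_smul_mem_range i y

variable {k : Fin m} {X : Type u} [AddCommGroup X] [Module (D.DiagQuotient k) X]

/-- Passing to the kernel discards exactly what the first column misses at position `k.succ`, so the
level rises by one. -/
theorem IsTop.admissible_ker {p : M →ₛₗ[D.diag k] X} (hp : IsTop p)
    (hM : D.Admissible (k + 1) M) :
    D.Admissible (k + 2) (LinearMap.ker (Inflate.ofSemilinear p)) := by
  have h := hM.ker isBelow_inflate.admissible (Inflate.ofSemilinear p)
  refine ⟨h.col_zero_smul, fun i hi x => ?_⟩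
  rcases lt_or_eq_of_le (Nat.lt_succ_iff.1 hi) with hi | hi
  · exact h.exists_col_smul i hi x
  · obtain rfl : i = k.succ := Fin.ext hi
    obtain ⟨y, hy⟩ := (hp.eq_zero_iff x).1 x.2
    refine ⟨⟨D.col 0 • y, semilinear_col_smul p 0 y⟩, Subtype.ext ?_⟩
    change D.idem k.succ • (x : M) = D.col k.succ • D.col 0 • y
    rw [smul_smul, col_mul_col_zero, hy]

theorem IsTop.isBelow_ker {p : M →ₛₗ[D.diag k] X} (hp : IsTop p) (hM : D.IsBelow (k + 1) M) :
    D.IsBelow (k + 2) (LinearMap.ker (Inflate.ofSemilinear p)) := by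
  intro i hi x
  refine Subtype.ext ?_
  change D.idem i • (x : M) = 0
  rcases lt_or_eq_of_le (Nat.lt_succ_iff.1 hi) with hi | hi
  · exact hM i hi x
  · obtain rfl : i = k.succ := Fin.ext hi
    obtain ⟨y, hy⟩ := (hp.eq_zero_iff x).1 x.2
    rw [hy, hM.col_smul]

/-- For an admissible projective cover P of the inflation, the top T of P maps onto X, so X is a
retract of T. The inflation of T is P modulo an admissible module of the next level, which costs one
dimension. -/
theorem hasProjDimLE_inflate_of_projective {c : ℕ} [Module.Projective (D.DiagQuotient k) X]
    (hc : ∀ (N : Type u) [AddCommGroup N] [Module D.Lambda N], D.Admissible (k + 2) N →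
      HasProjDimLE D.Lambda N c) : HasProjDimLE D.Lambda (Inflate (D.diag k) X) (c + 1) := by
  obtain ⟨P, _, _, g, _, hP, hg⟩ :=
    (isBelow_inflate (D := D) (k := k) (X := X)).admissible.exists_projective_surjective
  obtain ⟨T, _, _, t, ht⟩ := hP.exists_isTop
  obtain ⟨q, hq⟩ := exists_linearMap_of_semilinear (D.diag_surjective k) ht.surjective
    (ht.eq_zero_of_eq_zero (Inflate.toSemilinear g))
  have hq_surj : Function.Surjective q := fun x => by
    obtain ⟨y, hy⟩ := hg x
    exact ⟨t y, (hq y).trans hy⟩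
  obtain ⟨s, hs⟩ := Module.projective_lifting_property q LinearMap.id hq_surj
  have hT : HasProjDimLE D.Lambda (Inflate (D.diag k) T) (c + 1) :=
    HasProjDimLE.of_ker (g := Inflate.ofSemilinear t) ht.surjective
      (hc _ (ht.admissible_ker hP)) (Module.Projective.hasProjDimLE _)
  exact hT.of_retract (Inflate.map s) (Inflate.map q)
    (LinearMap.ext fun x => LinearMap.congr_fun hs x)

theorem hasProjDimLE_inflate {c n : ℕ}
    (hc : ∀ (N : Type u) [AddCommGroup N] [Module D.Lambda N], D.Admissible (k + 2) N →
      HasProjDimLE D.Lambda N c) : ∀ {X : Type u} [AddCommGroup X] [Module (D.DiagQuotient k) X],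
    HasProjDimLE (D.DiagQuotient k) X n →
      HasProjDimLE D.Lambda (Inflate (D.diag k) X) (c + 1 + n) := by
  induction n with
  | zero =>
    intro X _ _ h
    have := hasProjDimLE_zero_iff.1 h
    exact hasProjDimLE_inflate_of_projective hc
  | succ n ih =>
    intro X _ _ h
    obtain ⟨P, _, _, g, _, hg⟩ := exists_projective_surjective (D.DiagQuotient k) X
    exact (ih (h.ker hg)).right ((hasProjDimLE_inflate_of_projective (X := P) hc).mono (by omega))
      (f := Inflate.map (LinearMap.ker g).subtype) (g := Inflate.map g)
      (LinearMap.ker g).injective_subtype (LinearMap.exact_subtype_ker_map g) hg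

theorem IsBelow.hasProjDimLE {b d : ℕ} (hM : D.IsBelow (k + 1) M)
    (hA : leftGlobalDimension A ≤ b) (hd : leftGlobalDimension (D.DiagQuotient k) ≤ d)
    (hb : ∀ (N : Type u) [AddCommGroup N] [Module D.Lambda N], D.IsBelow (k + 2) N →
      HasProjDimLE D.Lambda N b) : HasProjDimLE D.Lambda M (b + 1 + d) := by
  obtain ⟨X, _, _, p, hp⟩ := hM.admissible.exists_isTop
  exact ((hb _ (hp.isBelow_ker hM)).mono (by omega)).middle
    (hasProjDimLE_inflate (fun N _ _ hN => hN.hasProjDimLE hA hb)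
      ((leftGlobalDimension_le_iff _).1 hd X))
    (LinearMap.ker (Inflate.ofSemilinear p)).injective_subtype
    (LinearMap.exact_subtype_ker_map _) hp.surjective

/-- Each position `k.succ` contributes `d k` for its top and 1 for inflating projectives. The bound
starts at `a`, although the module is zero when s = m, because each step needs a bound that also
dominates the dimension of A. -/
theorem hasProjDimLE_of_isBelow {a : ℕ} {d : Fin m → ℕ} (hA : leftGlobalDimension A ≤ a)
    (hd : ∀ k, leftGlobalDimension (D.DiagQuotient k) ≤ d k) {s : ℕ} (hs : s ≤ m) :
    ∀ (N : Type u) [AddCommGroup N] [Module D.Lambda N], D.IsBelow (s + 1) N →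
      HasProjDimLE D.Lambda N (a + ∑ k with s ≤ k.1, (d k + 1)) := by
  induction hs using Nat.decreasingInduction with
  | self =>
    intro N _ _ hN
    have : Subsingleton N := ⟨fun x y =>
      (D.eq_zero_of_idem_smul fun i => hN i i.2 x).trans
        (D.eq_zero_of_idem_smul fun i => hN i i.2 y).symm⟩
    exact hasProjDimLE_of_subsingleton _
  | of_succ s hs ih =>
    intro N _ _ hN
    have hsum : ∑ k : Fin m with s ≤ k.1, (d k + 1) =
        d ⟨s, hs⟩ + 1 + ∑ k : Fin m with s + 1 ≤ k.1, (d k + 1) := by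
      rw [← Finset.sum_insert (f := fun k => d k + 1) (by simp)]
      refine Finset.sum_congr (Finset.ext fun k => ?_) fun _ _ => rfl
      simp only [Finset.mem_filter, Finset.mem_univ, true_and, Finset.mem_insert, Fin.ext_iff]
      omega
    refine (IsBelow.hasProjDimLE (k := ⟨s, hs⟩) hN (hA.trans ?_) (hd _) ih).mono (by omega)
    exact_mod_cast Nat.le_add_right _ _

theorem leftGlobalDimension_lambda_le {a : ℕ} {d : Fin m → ℕ} (hA : leftGlobalDimension A ≤ a)
    (hd : ∀ k, leftGlobalDimension (D.DiagQuotient k) ≤ d k) :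
    leftGlobalDimension D.Lambda ≤ ((∑ k, d k + a + (m + 1) : ℕ) : ℕ∞) := by
  rw [leftGlobalDimension_le_iff]
  intro M _ _
  have hadm {N : Type u} [AddCommGroup N] [Module D.Lambda N]
      (h : ∀ i (x : N), D.col i • x = 0 → D.col 0 • x = 0) : D.Admissible 1 N :=
    ⟨h, fun i hi x => ⟨x, by rw [show i = 0 from Fin.ext (by simpa using hi), idem_zero]⟩⟩
  -- At level 1 the surjectivity condition concerns only position 0, where it is trivial, so
  -- submodules of free modules qualify.
  have hP : D.Admissible 1 (M →₀ D.Lambda) := by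
    refine Admissible.finsupp (hadm fun i x hx => ?_) M
    exact D.col_zero_mul_eq_zero hx
  have hg := Finsupp.linearCombination_id_surjective D.Lambda M
  have hker := hadm (N := LinearMap.ker (Finsupp.linearCombination D.Lambda (id : M → M)))
    fun i x hx => Subtype.ext (hP.col_zero_smul i x (congrArg Subtype.val hx))
  have hb := hasProjDimLE_of_isBelow hA hd m.zero_le
  refine (HasProjDimLE.of_ker hg (hker.hasProjDimLE (hA.trans ?_) hb)
    (Module.Projective.hasProjDimLE _)).mono ?_
  · exact_mod_cast Nat.le_add_right _ _
  · simp [Finset.sum_add_distrib]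
    omega

end UpperBound

end MatrixSubringData

/-! ### The two bounds in `ℕ∞` -/

theorem proposition4p9 {A : Type u} [Ring A] {m : ℕ} (D : MatrixSubringData A m) :
    max (⨆ i : Fin m, leftGlobalDimension (D.DiagQuotient i)) (leftGlobalDimension A) - 1
        ≤ leftGlobalDimension D.Lambda ∧
      leftGlobalDimension D.Lambda
        ≤ (∑ i : Fin m, leftGlobalDimension (D.DiagQuotient i)) + leftGlobalDimension A
          + ((m + 1 : ℕ) : ℕ∞) := by
  constructor
  -- The stronger inequality without the subtraction is proved.
  · refine tsub_le_self.trans ?_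
    cases h : leftGlobalDimension D.Lambda with
    | top => exact le_top
    | coe n =>
      obtain ⟨hA, hD⟩ := MatrixSubringData.leftGlobalDimension_le_of_lambda h.le
      exact max_le (iSup_le hD) hA
  · by_cases hA : leftGlobalDimension A = ⊤
    · rw [hA, add_top, top_add]
      exact le_top
    by_cases hD : ∃ k, leftGlobalDimension (D.DiagQuotient k) = ⊤
    · obtain ⟨k, hk⟩ := hD
      have : ∑ i : Fin m, leftGlobalDimension (D.DiagQuotient i) = ⊤ :=
        top_le_iff.1 (hk.symm.le.trans
          (Finset.single_le_sum (f := fun i => leftGlobalDimension (D.DiagQuotient i))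
            (fun _ _ => bot_le) (Finset.mem_univ k)))
      rw [this, top_add, top_add]
      exact le_top
    push Not at hD
    obtain ⟨a, ha⟩ := ENat.ne_top_iff_exists.1 hA
    choose d hd using fun k => ENat.ne_top_iff_exists.1 (hD k)
    refine (MatrixSubringData.leftGlobalDimension_lambda_le ha.symm.le
      fun k => (hd k).symm.le).trans ?_
    simp only [← ha, ← hd]
    push_cast
    exact le_rfl
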